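/- Let $L$ be a first order language in which every relation symbol $R$ and every function symbol $F$ carries a Lipschitz constant $\lambda_R,\lambda_F\geqslant 0$. An $L$-structure is a nonempty metric space $M$ with $d\leqslant 1$, with a $\lambda_R$-Lipschitz map $R^M:M^n\to[0,1]$ for each $n$-ary relation symbol $R$ and a $\lambda_F$-Lipschitz map $F^M:M^n\to M$ for each $n$-ary function symbol $F$, where $M^n$ carries the metric $\sum_{i} d(x_i,y_i)$. Formulas of continuous logic (CL) are built from $1$, $d(t_1,t_2)$ and $R(t_1,\dots,t_n)$ ($t_i$ terms) by $\phi+\psi$, $r\phi$ ($r\in\mathbb R$), $\phi\wedge\psi$ (minimum), $\phi\vee\psi$ (maximum), $\sup_x\phi$ and $\inf_x\phi$; formulas of affine logic (AL), called affine formulas, are those built without $\wedge$ and $\vee$. A CL-theory (affine theory) is a set of conditions $\phi\leqslant\psi$ between CL-sentences (affine sentences). Let $T$ be an affine theory. $T$ is complete if for every affine sentence $\phi$ there is a unique $r\in\mathbb R$ with $T\vDash\phi=r$. An $n$-type of $T$ is a positive linear functional $p$ with $p(1)=1$ on the partially ordered vector space of affine formulas in $n$ free variables up to $T$-equivalence,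 where $0\leqslant\phi$ means $T\vDash 0\leqslant\phi$; the type realized by $\bar a\in M^n$, $M\vDash T$, is $\phi\mapsto\phi^M(\bar a)$. A model of $T$ is extremal if every type that it realizes is an extreme point of the convex set of $n$-types of $T$ (for every $n$). We say that $T^{\mathrm{ex}}$ exists if the extremal models of $T$ are exactly the models of some CL-theory; $T^{\mathrm{ex}}$ is then the set of all CL-conditions that hold in every extremal model of $T$. A theory $S$ has quantifier-elimination in AL (resp. CL) if for every affine (resp. CL-) formula $\phi(\bar x)$ and every $\epsilon>0$ there is a quantifier-free affine (resp. CL-) formula $\psi(\bar x)$ with $S\vDash|\phi-\psi|\leqslant\epsilon$. It is model-complete in AL (resp. CL) if every embedding between models of $S$ preserves the values of all affine (resp. CL-) formulas. **Proposition.** Let $T$ be a complete affine theory such that $T^{\mathrm{ex}}$ exists. If $T$ has quantifier-elimination in AL, then $T^{\mathrm{ex}}$ has quantifier-elimination in CL. If $T$ is model-complete in AL, then $T^{\mathrm{ex}}$ is model-complete in CL. -/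

import Mathlib

open scoped NNReal

namespace AffineLogic

universe u v w

/-- A language: a first order language in which every function symbol and every relation symbol
carries a Lipschitz constant. The metric symbol `d` is not listed among the relation symbols;
it has its own constructor `Formula.d` among the atomic formulas. -/
structure MetricLanguage extends FirstOrder.Language.{u, v} where
  /-- The Lipschitz constant of a function symbol. -/
  funLip : ∀ {n : ℕ}, toLanguage.Functions n → ℝ≥0
  /-- The Lipschitz constant of a relation symbol. -/
  relLip : ∀ {n : ℕ}, toLanguage.Relations n → ℝ≥0

/-- A structure: a nonempty metric space whose metric takes values in `[0,1]`, with
interpretations `F : Mⁿ → M` and `R : Mⁿ → [0,1]` of the symbols that are Lipschitz, with the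
constants given by the language, for the sum metric `∑ i, d (x i) (y i)` on `Mⁿ`. -/
structure MetricStructure (L : MetricLanguage.{u, v}) where
  /-- The underlying set. -/
  carrier : Type w
  [metric : MetricSpace carrier]
  [nonempty : Nonempty carrier]
  dist_le_one : ∀ x y : carrier, dist x y ≤ 1
  /-- Interpretation of the function symbols. -/
  funMap : ∀ {n : ℕ}, L.Functions n → (Fin n → carrier) → carrier
  /-- Interpretation of the relation symbols. -/
  relMap : ∀ {n : ℕ}, L.Relations n → (Fin n → carrier) → ℝ
  relMap_mem : ∀ {n : ℕ} (R : L.Relations n) (x : Fin n → carrier), relMap R x ∈ Set.Icc (0 : ℝ) 1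
  funMap_lipschitz : ∀ {n : ℕ} (F : L.Functions n) (x y : Fin n → carrier),
    dist (funMap F x) (funMap F y) ≤ L.funLip F * ∑ i, dist (x i) (y i)
  relMap_lipschitz : ∀ {n : ℕ} (R : L.Relations n) (x y : Fin n → carrier),
    |relMap R x - relMap R y| ≤ L.relLip R * ∑ i, dist (x i) (y i)

attribute [instance] MetricStructure.metric MetricStructure.nonempty

/-- Formulas of continuous logic in the free variables `x₀, …, xₙ₋₁` (indexed by `Fin n`). The
quantifiers `sup` and `inf` bind the last variable. -/
inductive Formula (L : MetricLanguage.{u, v}) : ℕ → Type (max u v)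
  | one {n : ℕ} : Formula L n
  | d {n : ℕ} (t₁ t₂ : L.Term (Fin n)) : Formula L n
  | rel {n k : ℕ} (R : L.Relations k) (t : Fin k → L.Term (Fin n)) : Formula L n
  | add {n : ℕ} (φ ψ : Formula L n) : Formula L n
  | smul {n : ℕ} (r : ℝ) (φ : Formula L n) : Formula L n
  | min {n : ℕ} (φ ψ : Formula L n) : Formula L n
  | max {n : ℕ} (φ ψ : Formula L n) : Formula L n
  | sup {n : ℕ} (φ : Formula L (n + 1)) : Formula L n
  | inf {n : ℕ} (φ : Formula L (n + 1)) : Formula L n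

namespace Formula

variable {L : MetricLanguage.{u, v}}

/-- Affine formulas: those built without the lattice connectives. -/
def IsAffine : ∀ {n : ℕ}, Formula L n → Prop
  | _, one => True
  | _, d _ _ => True
  | _, rel _ _ => True
  | _, add φ ψ => φ.IsAffine ∧ ψ.IsAffine
  | _, smul _ φ => φ.IsAffine
  | _, min _ _ => False
  | _, max _ _ => False
  | _, sup φ => φ.IsAffine
  | _, inf φ => φ.IsAffine

/-- Quantifier-free formulas. -/
def IsQF : ∀ {n : ℕ}, Formula L n → Prop
  | _, one => True
  | _, d _ _ => True
  | _, rel _ _ => True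
  | _, add φ ψ => φ.IsQF ∧ ψ.IsQF
  | _, smul _ φ => φ.IsQF
  | _, min φ ψ => φ.IsQF ∧ ψ.IsQF
  | _, max φ ψ => φ.IsQF ∧ ψ.IsQF
  | _, sup _ => False
  | _, inf _ => False

end Formula

namespace MetricStructure

variable {L : MetricLanguage.{u, v}}

/-- The value of a term in a structure. -/
def termValue (M : MetricStructure.{u, v, w} L) {n : ℕ} (a : Fin n → M.carrier) :
    L.Term (Fin n) → M.carrier
  | .var i => a i
  | .func F t => M.funMap F fun i => M.termValue a (t i)

/-- The value `φ^M(a)` of a formula in a structure. -/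
noncomputable def eval (M : MetricStructure.{u, v, w} L) :
    ∀ {n : ℕ}, Formula L n → (Fin n → M.carrier) → ℝ
  | _, .one, _ => 1
  | _, .d t₁ t₂, a => dist (M.termValue a t₁) (M.termValue a t₂)
  | _, .rel R t, a => M.relMap R fun i => M.termValue a (t i)
  | _, .add φ ψ, a => M.eval φ a + M.eval ψ a
  | _, .smul r φ, a => r * M.eval φ a
  | _, .min φ ψ, a => Min.min (M.eval φ a) (M.eval ψ a)
  | _, .max φ ψ, a => Max.max (M.eval φ a) (M.eval ψ a)
  | _, .sup φ, a => ⨆ x : M.carrier, M.eval φ (Fin.snoc a x)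
  | _, .inf φ, a => ⨅ x : M.carrier, M.eval φ (Fin.snoc a x)

/-- Every formula is bounded in every structure, so that the suprema and infima in the definition
of `eval` are taken over nonempty bounded sets of reals. -/
theorem exists_abs_eval_le (M : MetricStructure.{u, v, w} L) {n : ℕ} (φ : Formula L n) :
    ∃ C : ℝ, ∀ a : Fin n → M.carrier, |M.eval φ a| ≤ C := by
  induction φ with
  | one => exact ⟨1, fun a => by simp [eval]⟩
  | d t₁ t₂ => exact ⟨1, fun a => by
      simpa [eval, abs_of_nonneg dist_nonneg] using M.dist_le_one _ _⟩
  | rel R t => exact ⟨1, fun a => by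
      have h := M.relMap_mem R fun i => M.termValue a (t i)
      simpa [eval, abs_of_nonneg h.1] using h.2⟩
  | add φ ψ hφ hψ =>
      obtain ⟨C, hC⟩ := hφ
      obtain ⟨D, hD⟩ := hψ
      exact ⟨C + D, fun a => (abs_add_le _ _).trans (add_le_add (hC a) (hD a))⟩
  | smul r φ hφ =>
      obtain ⟨C, hC⟩ := hφ
      exact ⟨|r| * C, fun a => by
        simpa [eval, abs_mul] using mul_le_mul_of_nonneg_left (hC a) (abs_nonneg r)⟩
  | min φ ψ hφ hψ =>
      obtain ⟨C, hC⟩ := hφ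
      obtain ⟨D, hD⟩ := hψ
      exact ⟨Max.max C D, fun a => abs_min_le_max_abs_abs.trans (max_le_max (hC a) (hD a))⟩
  | max φ ψ hφ hψ =>
      obtain ⟨C, hC⟩ := hφ
      obtain ⟨D, hD⟩ := hψ
      exact ⟨Max.max C D, fun a => abs_max_le_max_abs_abs.trans (max_le_max (hC a) (hD a))⟩
  | sup φ hφ =>
      obtain ⟨C, hC⟩ := hφ
      refine ⟨C, fun a => abs_le.2 ⟨?_, ciSup_le fun x => (abs_le.1 (hC _)).2⟩⟩
      obtain ⟨x⟩ := M.nonempty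
      exact (abs_le.1 (hC (Fin.snoc a x))).1.trans
        (le_ciSup (f := fun x : M.carrier => M.eval φ (Fin.snoc a x))
          ⟨C, by rintro _ ⟨y, rfl⟩; exact (abs_le.1 (hC _)).2⟩ x)
  | inf φ hφ =>
      obtain ⟨C, hC⟩ := hφ
      refine ⟨C, fun a => abs_le.2 ⟨le_ciInf fun x => (abs_le.1 (hC _)).1, ?_⟩⟩
      obtain ⟨x⟩ := M.nonempty
      exact (ciInf_le (f := fun x : M.carrier => M.eval φ (Fin.snoc a x))
          ⟨-C, by rintro _ ⟨y, rfl⟩; exact (abs_le.1 (hC _)).1⟩ x).trans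
        (abs_le.1 (hC (Fin.snoc a x))).2

/-- `f` is an embedding of the structure `M` into the structure `N`, i.e. an isomorphism of `M`
onto a substructure of `N`. -/
structure IsEmbedding (M N : MetricStructure.{u, v, w} L) (f : M.carrier → N.carrier) :
    Prop where
  isometry : Isometry f
  map_fun : ∀ {n : ℕ} (F : L.Functions n) (x : Fin n → M.carrier),
    f (M.funMap F x) = N.funMap F (f ∘ x)
  map_rel : ∀ {n : ℕ} (R : L.Relations n) (x : Fin n → M.carrier),
    N.relMap R (f ∘ x) = M.relMap R x

end MetricStructure

/-- The two logics: affine logic (AL) and continuous logic (CL). -/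
inductive Fragment
  | AL
  | CL

/-- The formulas of each logic. -/
def Fragment.Contains {L : MetricLanguage.{u, v}} {n : ℕ} : Fragment → Formula L n → Prop
  | .AL, φ => φ.IsAffine
  | .CL, _ => True

/-- A closed condition `lhs ≤ rhs`. -/
structure Condition (L : MetricLanguage.{u, v}) where
  /-- The left hand side. -/
  lhs : Formula L 0
  /-- The right hand side. -/
  rhs : Formula L 0

/-- A theory (of continuous logic) is a set of closed conditions. -/
abbrev Theory (L : MetricLanguage.{u, v}) := Set (Condition L)

/-- `M` satisfies the condition `c`. -/
def MetricStructure.Satisfies {L : MetricLanguage.{u, v}} (M : MetricStructure.{u, v, w} L)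
    (c : Condition L) : Prop :=
  M.eval c.lhs Fin.elim0 ≤ M.eval c.rhs Fin.elim0

/-- `M` is a model of `T`. -/
def MetricStructure.Models {L : MetricLanguage.{u, v}} (M : MetricStructure.{u, v, w} L)
    (T : Theory L) : Prop :=
  ∀ c ∈ T, M.Satisfies c

/-- Affine formulas in `n` free variables. -/
abbrev AffineFormula (L : MetricLanguage.{u, v}) (n : ℕ) := {φ : Formula L n // φ.IsAffine}

namespace AffineFormula

variable {L : MetricLanguage.{u, v}} {n : ℕ}

instance : One (AffineFormula L n) := ⟨⟨.one, trivial⟩⟩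

instance : Add (AffineFormula L n) := ⟨fun φ ψ => ⟨.add φ.1 ψ.1, φ.2, ψ.2⟩⟩

instance : SMul ℝ (AffineFormula L n) := ⟨fun r φ => ⟨.smul r φ.1, φ.2⟩⟩

end AffineFormula

/- From here on models are taken in `Type (max u v)`. By the downward Löwenheim-Skolem theorem
this universe, which contains the language, is large enough for all the notions below. -/
namespace Theory

variable {L : MetricLanguage.{u, v}}

/-- An affine theory: all its conditions are between affine sentences. -/
def IsAffine (T : Theory L) : Prop :=
  ∀ c ∈ T, c.lhs.IsAffine ∧ c.rhs.IsAffine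

/-- Completeness in affine logic: for every affine sentence `φ` there is a unique real `r`
with `T ⊨ φ = r`. In particular `T` is satisfiable. -/
def IsAffinelyComplete (T : Theory L) : Prop :=
  ∀ φ : AffineFormula L 0, ∃! r : ℝ,
    ∀ M : MetricStructure.{u, v, max u v} L, M.Models T → M.eval φ.1 Fin.elim0 = r

/-- `K_n(T)`, the set of affine `n`-types of `T`: the positive normalized linear functionals on
affine formulas `φ(x₀, …, xₙ₋₁)`, where `0 ≤ φ` means `T ⊨ 0 ≤ φ`. Such a functional takes equal
values on `T`-equivalent formulas, so that these are exactly the positive linear functionals `p`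
with `p 1 = 1` on the partially ordered vector space `D_n(T)` of affine formulas up to
`T`-equivalence. -/
def typeSpace (T : Theory L) (n : ℕ) : Set (AffineFormula L n → ℝ) :=
  {p | (∀ φ ψ, p (φ + ψ) = p φ + p ψ) ∧
    (∀ (r : ℝ) φ, p (r • φ) = r * p φ) ∧
    (∀ φ : AffineFormula L n,
      (∀ M : MetricStructure.{u, v, max u v} L, M.Models T → ∀ a, 0 ≤ M.eval φ.1 a) → 0 ≤ p φ) ∧
    p 1 = 1}

/-- `E_n(T)`, the set of extreme affine `n`-types of `T`. -/
def extremeTypes (T : Theory L) (n : ℕ) : Set (AffineFormula L n → ℝ) :=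
  (T.typeSpace n).extremePoints ℝ

/-- An extremal model of `T`: a model which realizes only extreme types. -/
def IsExtremalModel (T : Theory L) (M : MetricStructure.{u, v, max u v} L) : Prop :=
  M.Models T ∧ ∀ (n : ℕ) (a : Fin n → M.carrier),
    (fun φ : AffineFormula L n => M.eval φ.1 a) ∈ T.extremeTypes n

/-- `T^ex` exists: the extremal models of `T` form an elementary class in continuous logic. -/
def ExtremalTheoryExists (T : Theory L) : Prop :=
  ∃ S : Theory L, ∀ M : MetricStructure.{u, v, max u v} L, M.Models S ↔ T.IsExtremalModel M

/-- `T^ex`, the continuous theory of the class of extremal models of `T`. -/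
def extremalTheory (T : Theory L) : Theory L :=
  {c | ∀ M : MetricStructure.{u, v, max u v} L, T.IsExtremalModel M → M.Satisfies c}

/-- If `T^ex` exists, then its models are exactly the extremal models of `T`. -/
theorem ExtremalTheoryExists.models_iff {T : Theory L} (h : T.ExtremalTheoryExists)
    (M : MetricStructure.{u, v, max u v} L) :
    M.Models T.extremalTheory ↔ T.IsExtremalModel M := by
  obtain ⟨S, hS⟩ := h
  exact ⟨fun hM => (hS M).1 fun c hc => hM c fun N hN => (hS N).2 hN c hc,
    fun hM c hc => hc M hM⟩

/-- Quantifier-elimination in the given logic: every formula `φ(x)` of the logic is, up to every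
`ε > 0`, uniformly approximated in the models of `T` by a quantifier-free formula `ψ(x)` of the
logic. -/
def HasQuantifierElimination (T : Theory L) (F : Fragment) : Prop :=
  ∀ (n : ℕ) (φ : Formula L n), F.Contains φ → ∀ ε : ℝ, 0 < ε →
    ∃ ψ : Formula L n, F.Contains ψ ∧ ψ.IsQF ∧
      ∀ M : MetricStructure.{u, v, max u v} L, M.Models T →
        ∀ a, |M.eval φ a - M.eval ψ a| ≤ ε

/-- Model-completeness in the given logic: every embedding between models of `T` is elementary,
i.e. preserves the values of all formulas of the logic. -/
def IsModelComplete (T : Theory L) (F : Fragment) : Prop :=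
  ∀ M N : MetricStructure.{u, v, max u v} L, M.Models T → N.Models T →
    ∀ f : M.carrier → N.carrier, M.IsEmbedding N f →
      ∀ (n : ℕ) (φ : Formula L n), F.Contains φ →
        ∀ a : Fin n → M.carrier, N.eval φ (f ∘ a) = M.eval φ a

end Theory

end AffineLogic

/-! The core is that, among extremal models of `T`, the affine type of a tuple determines its values
on all CL-formulas, provided `T^ex` exists (`eval_eq_of_affineType_eq`). This is a back-and-forth
argument. Let `a` in `M` and `b` in `N` have the same affine type, and let `c` be in `M`. If the
type of `(a, c)` lay outside the closed convex hull of the types of `(b, d)`, `d` in `N`,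
Hahn–Banach would give an affine `φ` with `sup φ` larger at `a` than at `b`; but `sup φ` is affine.
Since the type of `(a, c)` is extreme, Milman's theorem puts it in the closure of the types of `(b,
d)`, so an ultrapower of `N` realizes it over `b`. That ultrapower is again extremal because the
extremal models form an elementary class, and induction on formulas goes through.

Model-completeness transfers at once: an embedding preserves affine types, hence CL-values. For
quantifier-elimination, tuples with equal quantifier-free values have equal affine types, hence
equal CL-values; compactness and the lattice form of Stone–Weierstrass turn this separation into
uniform approximation. -/

namespace AffineLogic

open Filter Topology

universe u v w

/-! ### Extreme points and Milman's theorem -/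

section Milman

variable {E : Type*} [AddCommGroup E] [Module ℝ E] [TopologicalSpace E] [IsTopologicalAddGroup E]
  [ContinuousSMul ℝ E]

theorem isCompact_convexJoin {s t : Set E} (hs : IsCompact s) (ht : IsCompact t) :
    IsCompact (convexJoin ℝ s t) := by
  have h : convexJoin ℝ s t =
      (fun z : (E × E) × ℝ => (1 - z.2) • z.1.1 + z.2 • z.1.2) '' ((s ×ˢ t) ×ˢ Set.Icc 0 1) := by
    ext x
    simp only [mem_convexJoin, segment_eq_image, Set.mem_image, Set.mem_prod, Prod.exists]
    constructor
    · rintro ⟨a, ha, b, hb, θ, hθ, rfl⟩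
      exact ⟨a, b, θ, ⟨⟨ha, hb⟩, hθ⟩, rfl⟩
    · rintro ⟨a, b, θ, ⟨⟨ha, hb⟩, hθ⟩, rfl⟩
      exact ⟨a, ha, b, hb, θ, hθ, rfl⟩
  rw [h]
  exact ((hs.prod ht).prod isCompact_Icc).image (by fun_prop)

/-- An extreme point of a compact convex set which lies in the closed convex hull of a union
of two subsets lies in the closed convex hull of one of them. -/
theorem mem_closedConvexHull_of_mem_union [T2Space E] {K s t : Set E} {q : E} (hK : IsCompact K)
    (hKc : Convex ℝ K) (hs : s ⊆ K) (ht : t ⊆ K) (hq : q ∈ K.extremePoints ℝ)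
    (h : q ∈ closedConvexHull ℝ (s ∪ t)) :
    q ∈ closedConvexHull ℝ s ∨ q ∈ closedConvexHull ℝ t := by
  rcases s.eq_empty_or_nonempty with rfl | hs₀
  · right; simpa using h
  rcases t.eq_empty_or_nonempty with rfl | ht₀
  · left; simpa using h
  have hsK : closedConvexHull ℝ s ⊆ K := closedConvexHull_min hs hKc hK.isClosed
  have htK : closedConvexHull ℝ t ⊆ K := closedConvexHull_min ht hKc hK.isClosed
  -- The join of two compact convex sets is already compact and convex, so `q` lies on a segment
  -- between the two hulls; extremality makes it an endpoint.
  have hj : closedConvexHull ℝ (s ∪ t) ⊆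
      convexJoin ℝ (closedConvexHull ℝ s) (closedConvexHull ℝ t) := by
    refine closedConvexHull_min (Set.union_subset ?_ ?_) ?_ ?_
    · exact subset_closedConvexHull.trans
        (subset_convexJoin_left (ht₀.mono subset_closedConvexHull))
    · exact subset_closedConvexHull.trans
        (subset_convexJoin_right (hs₀.mono subset_closedConvexHull))
    · exact convex_closedConvexHull.convexJoin convex_closedConvexHull
    · exact (isCompact_convexJoin (hK.of_isClosed_subset isClosed_closedConvexHull hsK)
        (hK.of_isClosed_subset isClosed_closedConvexHull htK)).isClosed
  obtain ⟨a, ha, b, hb, hab⟩ := mem_convexJoin.1 (hj h)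
  rcases (mem_extremePoints_iff_forall_segment.1 hq).2 a (hsK ha) b (htK hb) hab with rfl | rfl
  · exact Or.inl ha
  · exact Or.inr hb

/-- **Milman's theorem**, the partial converse of the Krein–Milman theorem. -/
theorem mem_closure_of_mem_extremePoints [T2Space E] [LocallyConvexSpace ℝ E] {K X : Set E} {q : E}
    (hK : IsCompact K) (hKc : Convex ℝ K) (hX : X ⊆ K) (hq : q ∈ K.extremePoints ℝ)
    (h : q ∈ closedConvexHull ℝ X) : q ∈ closure X := by
  by_contra hqX
  have hcl : closure X ⊆ K := closure_minimal hX hK.isClosed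
  have hcomp : IsCompact (closure X) := hK.of_isClosed_subset isClosed_closure hcl
  have key : q ∉ closedConvexHull ℝ (closure X ∩ K) := by
    -- The property passes to finite unions by the preceding lemma, so it suffices to check it near
    -- each point. Intersecting with `K` is needed because the induction runs over arbitrary sets.
    refine hcomp.induction_on (p := fun s => q ∉ closedConvexHull ℝ (s ∩ K)) ?_ ?_ ?_ ?_
    · intro h₀
      exact closedConvexHull_min (Set.empty_subset ∅) convex_empty isClosed_empty (by simpa using h₀)
    · intro s t hst ht hs
      exact ht ((closedConvexHull ℝ).monotone (Set.inter_subset_inter_left K hst) hs)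
    · intro s t hs ht hst
      rw [Set.union_inter_distrib_right] at hst
      exact (mem_closedConvexHull_of_mem_union hK hKc Set.inter_subset_right
        Set.inter_subset_right hq hst).elim hs ht
    · intro x hx
      have hxq : x ≠ q := fun e => hqX (e ▸ hx)
      obtain ⟨u, v, hu, hv, hxu, hqv, huv⟩ := t2_separation hxq
      obtain ⟨V, ⟨hV, hVc⟩, hVu⟩ :=
        (LocallyConvexSpace.convex_basis (𝕜 := ℝ) x).mem_iff.1 (hu.mem_nhds hxu)
      refine ⟨V, mem_nhdsWithin_of_mem_nhds hV, fun hqV => ?_⟩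
      have h1 : q ∈ closure V := closedConvexHull_min
        (Set.inter_subset_left.trans subset_closure) hVc.closure isClosed_closure hqV
      obtain ⟨y, hyv, hyV⟩ := mem_closure_iff.1 h1 v hv hqv
      exact huv.le_bot ⟨hVu hyV, hyv⟩
  apply key
  rw [Set.inter_eq_left.2 hcl, closedConvexHull_closure_eq_closedConvexHull]
  exact h

end Milman

/-- A continuous linear functional on a product of copies of `ℝ` depends on finitely many
coordinates. -/
theorem exists_finset_forall_eq_sum {ι : Type*} (f : (ι → ℝ) →L[ℝ] ℝ) :
    ∃ (s : Finset ι) (r : ι → ℝ), ∀ x, f x = ∑ i ∈ s, r i * x i := by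
  classical
  have h0 : f ⁻¹' Metric.ball 0 1 ∈ 𝓝 (0 : ι → ℝ) :=
    f.continuous.continuousAt.preimage_mem_nhds (by simpa using Metric.ball_mem_nhds (0 : ℝ) one_pos)
  rw [nhds_pi, Filter.mem_pi'] at h0
  obtain ⟨s, t, ht, hst⟩ := h0
  have hz : ∀ x : ι → ℝ, (∀ i ∈ s, x i = 0) → f x = 0 := by
    intro x hx
    by_contra hfx
    -- The basic neighbourhood restricts only coordinates in `s`, so it contains every multiple of
    -- `x`; but `f` takes the value 1 at this one.
    have : (f x)⁻¹ • x ∈ f ⁻¹' Metric.ball 0 1 := hst fun i hi => by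
      simpa [hx i hi] using mem_of_mem_nhds (ht i)
    simp [hfx] at this
  refine ⟨s, fun i => f (Pi.single i 1), fun x => ?_⟩
  have h1 : f (x - ∑ i ∈ s, x i • Pi.single i (1 : ℝ)) = 0 := hz _ fun j hj => by
    simp [Finset.sum_apply, Pi.single_apply, hj]
  rw [map_sub, sub_eq_zero] at h1
  simp [h1, map_sum, mul_comm]

/-! ### Bounds on formulas and the quantifiers -/

variable {L : MetricLanguage.{u, v}}

/-- Every formula is bounded, uniformly over all structures. -/
theorem Formula.exists_forall_abs_eval_le {n : ℕ} (φ : Formula L n) :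
    ∃ C : ℝ, ∀ (M : MetricStructure.{u, v, w} L) (a : Fin n → M.carrier), |M.eval φ a| ≤ C := by
  induction φ with
  | one => exact ⟨1, fun M a => by simp [MetricStructure.eval]⟩
  | d t₁ t₂ => exact ⟨1, fun M a => by
      simpa [MetricStructure.eval, abs_of_nonneg dist_nonneg] using M.dist_le_one _ _⟩
  | rel R t => exact ⟨1, fun M a => by
      have h := M.relMap_mem R fun i => M.termValue a (t i)
      simpa [MetricStructure.eval, abs_of_nonneg h.1] using h.2⟩
  | add φ ψ hφ hψ =>
      obtain ⟨C, hC⟩ := hφ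
      obtain ⟨D, hD⟩ := hψ
      exact ⟨C + D, fun M a => (abs_add_le _ _).trans (add_le_add (hC M a) (hD M a))⟩
  | smul r φ hφ =>
      obtain ⟨C, hC⟩ := hφ
      exact ⟨|r| * C, fun M a => by
        simpa [MetricStructure.eval, abs_mul] using
          mul_le_mul_of_nonneg_left (hC M a) (abs_nonneg r)⟩
  | min φ ψ hφ hψ =>
      obtain ⟨C, hC⟩ := hφ
      obtain ⟨D, hD⟩ := hψ
      exact ⟨Max.max C D, fun M a =>
        abs_min_le_max_abs_abs.trans (max_le_max (hC M a) (hD M a))⟩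
  | max φ ψ hφ hψ =>
      obtain ⟨C, hC⟩ := hφ
      obtain ⟨D, hD⟩ := hψ
      exact ⟨Max.max C D, fun M a =>
        abs_max_le_max_abs_abs.trans (max_le_max (hC M a) (hD M a))⟩
  | sup φ hφ =>
      obtain ⟨C, hC⟩ := hφ
      refine ⟨C, fun M a => abs_le.2 ⟨?_, ciSup_le fun x => (abs_le.1 (hC M _)).2⟩⟩
      obtain ⟨x⟩ := M.nonempty
      exact (abs_le.1 (hC M (Fin.snoc a x))).1.trans
        (le_ciSup (f := fun x : M.carrier => M.eval φ (Fin.snoc a x))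
          ⟨C, by rintro _ ⟨y, rfl⟩; exact (abs_le.1 (hC M _)).2⟩ x)
  | inf φ hφ =>
      obtain ⟨C, hC⟩ := hφ
      refine ⟨C, fun M a => abs_le.2 ⟨le_ciInf fun x => (abs_le.1 (hC M _)).1, ?_⟩⟩
      obtain ⟨x⟩ := M.nonempty
      exact (ciInf_le (f := fun x : M.carrier => M.eval φ (Fin.snoc a x))
          ⟨-C, by rintro _ ⟨y, rfl⟩; exact (abs_le.1 (hC M _)).1⟩ x).trans
        (abs_le.1 (hC M (Fin.snoc a x))).2

namespace MetricStructure

theorem eval_le_eval_sup (M : MetricStructure.{u, v, w} L) {n : ℕ} (φ : Formula L (n + 1))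
    (a : Fin n → M.carrier) (x : M.carrier) :
    M.eval φ (Fin.snoc a x) ≤ M.eval (.sup φ) a := by
  obtain ⟨C, hC⟩ := M.exists_abs_eval_le φ
  exact le_ciSup (f := fun x : M.carrier => M.eval φ (Fin.snoc a x))
    ⟨C, by rintro _ ⟨y, rfl⟩; exact (abs_le.1 (hC _)).2⟩ x

theorem eval_sup_le (M : MetricStructure.{u, v, w} L) {n : ℕ} {φ : Formula L (n + 1)}
    {a : Fin n → M.carrier} {C : ℝ} (h : ∀ x, M.eval φ (Fin.snoc a x) ≤ C) :
    M.eval (.sup φ) a ≤ C :=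
  ciSup_le h

theorem eval_inf_eq_neg_eval_sup (M : MetricStructure.{u, v, w} L) {n : ℕ}
    (φ : Formula L (n + 1)) (a : Fin n → M.carrier) :
    M.eval (.inf φ) a = -M.eval (.sup (.smul (-1) φ)) a := by
  obtain ⟨C, hC⟩ := M.exists_abs_eval_le φ
  apply le_antisymm
  · rw [le_neg]
    refine M.eval_sup_le fun x => ?_
    have : M.eval (.inf φ) a ≤ M.eval φ (Fin.snoc a x) :=
      ciInf_le (f := fun x : M.carrier => M.eval φ (Fin.snoc a x))
        ⟨-C, by rintro _ ⟨y, rfl⟩; exact (abs_le.1 (hC _)).1⟩ x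
    simpa [eval] using this
  · refine le_ciInf fun x => ?_
    have := M.eval_le_eval_sup (.smul (-1) φ) a x
    simp only [eval, neg_mul, one_mul] at this ⊢
    linarith

end MetricStructure

/-- Compactness of `[-C, C]` provides an ultralimit, so `limUnder` is not a default value here. -/
theorem tendsto_limUnder_of_abs_le {I : Type*} (U : Ultrafilter I) {f : I → ℝ} {C : ℝ}
    (h : ∀ i, |f i| ≤ C) : Tendsto f U (𝓝 (limUnder (U : Filter I) f)) := by
  obtain ⟨x, -, hx⟩ := (isCompact_Icc (a := -C) (b := C)).ultrafilter_le_nhds (U.map f)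
    (by rw [le_principal_iff]; exact Eventually.of_forall (f := (U : Filter I))
          fun i => abs_le.1 (h i))
  exact tendsto_nhds_limUnder ⟨x, hx⟩

/-! ### Ultraproducts, Łoś's theorem and compactness -/

section Ultraproduct

variable {I : Type w} (U : Ultrafilter I) (M : I → MetricStructure.{u, v, w} L)

/-- The product of the underlying sets, carrying the limit pseudometric along `U`. -/
@[nolint unusedArguments]
def PreUltraproduct (_U : Ultrafilter I) (M : I → MetricStructure.{u, v, w} L) : Type w :=
  ∀ i, (M i).carrier

theorem tendsto_dist_limUnder (x y : ∀ i, (M i).carrier) :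
    Tendsto (fun i => dist (x i) (y i)) U
      (𝓝 (limUnder (U : Filter I) fun i => dist (x i) (y i))) :=
  tendsto_limUnder_of_abs_le U (C := 1) fun i => by
    rw [abs_of_nonneg dist_nonneg]; exact (M i).dist_le_one _ _

noncomputable instance : PseudoMetricSpace (PreUltraproduct U M) where
  dist x y := limUnder (U : Filter I) fun i => dist (x i) (y i)
  dist_self x := (show Tendsto (fun i => dist (x i) (x i)) U (𝓝 0) by
    simp).limUnder_eq
  dist_comm x y := by simp only [dist_comm]
  dist_triangle x y z := le_of_tendsto_of_tendsto' (tendsto_dist_limUnder U M x z)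
    ((tendsto_dist_limUnder U M x y).add (tendsto_dist_limUnder U M y z))
    fun i => dist_triangle _ _ _

namespace PreUltraproduct

/-- The class of a family of elements in the ultraproduct. -/
noncomputable abbrev mk (x : ∀ i, (M i).carrier) : SeparationQuotient (PreUltraproduct U M) :=
  SeparationQuotient.mk (X := PreUltraproduct U M) x

variable {U M} in
/-- A representative of an element of the ultraproduct. -/
noncomputable def rep (x : SeparationQuotient (PreUltraproduct U M)) : ∀ i, (M i).carrier :=
  Function.surjInv (SeparationQuotient.surjective_mk (X := PreUltraproduct U M)) x

theorem mk_rep (x : SeparationQuotient (PreUltraproduct U M)) : mk U M (rep x) = x :=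
  Function.surjInv_eq (SeparationQuotient.surjective_mk (X := PreUltraproduct U M)) x

theorem tendsto_dist_mk (x y : ∀ i, (M i).carrier) :
    Tendsto (fun i => dist (x i) (y i)) U (𝓝 (dist (mk U M x) (mk U M y))) :=
  tendsto_dist_limUnder U M x y

theorem tendsto_dist_rep (x y : SeparationQuotient (PreUltraproduct U M)) :
    Tendsto (fun i => dist (rep x i) (rep y i)) U (𝓝 (dist x y)) := by
  simpa only [mk_rep] using tendsto_dist_mk U M (rep x) (rep y)

theorem tendsto_dist_rep_mk (x : ∀ i, (M i).carrier) :
    Tendsto (fun i => dist (rep (mk U M x) i) (x i)) U (𝓝 0) := by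
  simpa only [mk_rep, dist_self] using tendsto_dist_mk U M (rep (mk U M x)) x

theorem tendsto_relMap_limUnder {n : ℕ} (R : L.Relations n) (x : ∀ i, Fin n → (M i).carrier) :
    Tendsto (fun i => (M i).relMap R (x i)) U
      (𝓝 (limUnder (U : Filter I) fun i => (M i).relMap R (x i))) :=
  tendsto_limUnder_of_abs_le U (C := 1) fun i => by
    have h := (M i).relMap_mem R (x i)
    rw [abs_of_nonneg h.1]; exact h.2

end PreUltraproduct

open PreUltraproduct

/-- The ultraproduct of a family of structures. -/
noncomputable def ultraproduct : MetricStructure.{u, v, w} L where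
  carrier := SeparationQuotient (PreUltraproduct U M)
  nonempty := ⟨mk U M fun i => Classical.choice (M i).nonempty⟩
  dist_le_one x y := le_of_tendsto' (tendsto_dist_rep U M x y) fun i => (M i).dist_le_one _ _
  funMap F x := mk U M fun i => (M i).funMap F fun j => rep (x j) i
  relMap R x := limUnder (U : Filter I) fun i => (M i).relMap R fun j => rep (x j) i
  relMap_mem R x := isClosed_Icc.mem_of_tendsto
    (tendsto_relMap_limUnder U M R fun i j => rep (x j) i)
    (Eventually.of_forall fun i => (M i).relMap_mem _ _)
  funMap_lipschitz F x y := le_of_tendsto_of_tendsto' (tendsto_dist_mk U M _ _)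
    ((tendsto_finsetSum _ fun j _ => tendsto_dist_rep U M (x j) (y j)).const_mul _)
    fun i => (M i).funMap_lipschitz F _ _
  relMap_lipschitz R x y := le_of_tendsto_of_tendsto'
    ((tendsto_relMap_limUnder U M R fun i j => rep (x j) i).sub
      (tendsto_relMap_limUnder U M R fun i j => rep (y j) i)).abs
    ((tendsto_finsetSum _ fun j _ => tendsto_dist_rep U M (x j) (y j)).const_mul _)
    fun i => (M i).relMap_lipschitz R _ _

theorem tendsto_sum_dist_rep_mk {n : ℕ} (c : ℝ) (x : Fin n → ∀ i, (M i).carrier) :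
    Tendsto (fun i => c * ∑ j, dist (rep (mk U M (x j)) i) (x j i)) U (𝓝 0) := by
  simpa using
    (tendsto_finsetSum Finset.univ fun j _ => tendsto_dist_rep_mk U M (x j)).const_mul c

/-- The Lipschitz bound makes the interpretation independent of the representatives chosen by `rep`.
-/
theorem ultraproduct_funMap_mk {n : ℕ} (F : L.Functions n) (x : Fin n → ∀ i, (M i).carrier) :
    (ultraproduct U M).funMap F (fun j => mk U M (x j)) =
      mk U M fun i => (M i).funMap F fun j => x j i := by
  refine eq_of_dist_eq_zero (le_antisymm ?_ dist_nonneg)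
  exact le_of_tendsto_of_tendsto' (tendsto_dist_mk U M _ _)
    (tendsto_sum_dist_rep_mk U M (L.funLip F) x) fun i => (M i).funMap_lipschitz F _ _

theorem tendsto_relMap_ultraproduct {n : ℕ} (R : L.Relations n)
    (x : Fin n → ∀ i, (M i).carrier) :
    Tendsto (fun i => (M i).relMap R fun j => x j i) U
      (𝓝 ((ultraproduct U M).relMap R fun j => mk U M (x j))) := by
  have h1 : Tendsto (fun i => (M i).relMap R fun j => rep (mk U M (x j)) i) U
      (𝓝 ((ultraproduct U M).relMap R fun j => mk U M (x j))) :=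
    tendsto_relMap_limUnder U M R fun i j => rep (mk U M (x j)) i
  have h2 : Tendsto (fun i => ((M i).relMap R fun j => rep (mk U M (x j)) i) -
      (M i).relMap R fun j => x j i) U (𝓝 0) :=
    squeeze_zero_norm (fun i => (M i).relMap_lipschitz R _ _)
      (tendsto_sum_dist_rep_mk U M (L.relLip R) x)
  simpa using h1.sub h2

theorem ultraproduct_termValue {n : ℕ} (a : Fin n → ∀ i, (M i).carrier) (t : L.Term (Fin n)) :
    (ultraproduct U M).termValue (fun j => mk U M (a j)) t =
      mk U M fun i => (M i).termValue (fun j => a j i) t := by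
  induction t with
  | var j => rfl
  | func F t ih =>
      simp only [MetricStructure.termValue, ih]
      exact ultraproduct_funMap_mk U M F fun j i => (M i).termValue (fun j => a j i) (t j)

theorem snoc_mk {n : ℕ} (a : Fin n → ∀ i, (M i).carrier) (x : ∀ i, (M i).carrier) :
    (Fin.snoc (fun j => mk U M (a j)) (mk U M x) : Fin (n + 1) → (ultraproduct U M).carrier) =
      fun j => mk U M ((Fin.snoc a x : Fin (n + 1) → ∀ i, (M i).carrier) j) := by
  funext j
  refine Fin.lastCases ?_ (fun j => ?_) j
  · rw [Fin.snoc_last]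
    exact Fin.snoc_last (α := fun _ => (ultraproduct U M).carrier) _ _
  · rw [Fin.snoc_castSucc]
    exact Fin.snoc_castSucc (α := fun _ => (ultraproduct U M).carrier) _ _ _

theorem snoc_apply_apply {n : ℕ} (a : Fin n → ∀ i, (M i).carrier) (x : ∀ i, (M i).carrier)
    (i : I) :
    (Fin.snoc (fun j => a j i) (x i) : Fin (n + 1) → (M i).carrier) =
      fun j => (Fin.snoc a x : Fin (n + 1) → ∀ i, (M i).carrier) j i := by
  ext j
  refine Fin.lastCases ?_ (fun j => ?_) j <;> simp

/-- The quantifier step of Łoś's theorem. -/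
theorem tendsto_eval_sup {n : ℕ} {φ : Formula L (n + 1)}
    (h : ∀ a : Fin (n + 1) → ∀ i, (M i).carrier,
      Tendsto (fun i => (M i).eval φ fun j => a j i) U
        (𝓝 ((ultraproduct U M).eval φ fun j => mk U M (a j))))
    (a : Fin n → ∀ i, (M i).carrier) :
    Tendsto (fun i => (M i).eval (.sup φ) fun j => a j i) U
      (𝓝 ((ultraproduct U M).eval (.sup φ) fun j => mk U M (a j))) := by
  have h' : ∀ x : ∀ i, (M i).carrier,
      Tendsto (fun i => (M i).eval φ (Fin.snoc (fun j => a j i) (x i))) U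
        (𝓝 ((ultraproduct U M).eval φ
          (Fin.snoc (fun j => mk U M (a j)) (mk U M x) :
            Fin (n + 1) → (ultraproduct U M).carrier))) := by
    intro x
    rw [snoc_mk]
    simpa only [snoc_apply_apply] using h (Fin.snoc a x)
  obtain ⟨C, hC⟩ := (Formula.sup φ).exists_forall_abs_eval_le
  have hl := tendsto_limUnder_of_abs_le U fun i => hC (M i) fun j => a j i
  have e : (ultraproduct U M).eval (.sup φ) (fun j => mk U M (a j)) =
      limUnder (U : Filter I) fun i => (M i).eval (.sup φ) fun j => a j i := by
    apply le_antisymm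
    · refine MetricStructure.eval_sup_le _ fun y => ?_
      rw [← mk_rep U M y]
      exact le_of_tendsto_of_tendsto' (h' _) hl fun i => (M i).eval_le_eval_sup _ _ _
    · refine le_of_forall_pos_sub_le fun ε hε => ?_
      -- Near-optimal witnesses in the factors assemble to one element of the ultraproduct, whose
      -- value is within `ε` of the limit of the suprema.
      have hx : ∀ i, ∃ x, (M i).eval (.sup φ) (fun j => a j i) - ε <
          (M i).eval φ (Fin.snoc (fun j => a j i) x) := fun i =>
        exists_lt_of_lt_ciSup (sub_lt_self _ hε)
      choose x hx using hx
      exact (le_of_tendsto_of_tendsto' (hl.sub_const ε) (h' x) fun i => (hx i).le).trans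
        (MetricStructure.eval_le_eval_sup _ _ _ _)
  rw [e]
  exact hl

/-- **Łoś's theorem** for continuous logic. -/
theorem tendsto_eval_ultraproduct {n : ℕ} (φ : Formula L n) (a : Fin n → ∀ i, (M i).carrier) :
    Tendsto (fun i => (M i).eval φ fun j => a j i) U
      (𝓝 ((ultraproduct U M).eval φ fun j => mk U M (a j))) := by
  induction φ with
  | one => exact tendsto_const_nhds
  | d t₁ t₂ =>
      simp only [MetricStructure.eval, ultraproduct_termValue]
      exact tendsto_dist_mk U M _ _
  | rel R t =>
      simp only [MetricStructure.eval, ultraproduct_termValue]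
      exact tendsto_relMap_ultraproduct U M R fun k i => (M i).termValue (fun j => a j i) (t k)
  | add φ ψ hφ hψ => exact (hφ a).add (hψ a)
  | smul r φ hφ => exact (hφ a).const_mul r
  | min φ ψ hφ hψ => exact (hφ a).min (hψ a)
  | max φ ψ hφ hψ => exact (hφ a).max (hψ a)
  | sup φ hφ => exact tendsto_eval_sup U M hφ a
  | inf φ hφ =>
      have h := (tendsto_eval_sup U M (φ := .smul (-1) φ) (fun a => (hφ a).const_mul (-1)) a).neg
      refine (h.congr fun i => ((M i).eval_inf_eq_neg_eval_sup φ _).symm).mono_right ?_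
      exact (congrArg 𝓝 ((ultraproduct U M).eval_inf_eq_neg_eval_sup φ _).symm).le

theorem ultraproduct_models {S : Theory L} (h : ∀ i, (M i).Models S) :
    (ultraproduct U M).Models S := by
  intro c hc
  have e : (Fin.elim0 : Fin 0 → (ultraproduct U M).carrier) =
      fun j => mk U M (Fin.elim0 j : ∀ i, (M i).carrier) := Subsingleton.elim _ _
  have e' : ∀ i, (fun j : Fin 0 => (Fin.elim0 j : ∀ i, (M i).carrier) i) = Fin.elim0 :=
    fun i => Subsingleton.elim _ _
  unfold MetricStructure.Satisfies
  rw [e]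
  refine le_of_tendsto_of_tendsto' (tendsto_eval_ultraproduct U M c.lhs _)
    (tendsto_eval_ultraproduct U M c.rhs _) fun i => ?_
  rw [e']
  exact h i c hc

end Ultraproduct

/-- The compactness theorem for continuous logic. -/
theorem exists_models_forall_nonneg {S : Theory L} {n : ℕ} (Γ : Set (Formula L n))
    (h : ∀ s : Finset Γ, ∃ M : MetricStructure.{u, v, max u v} L, M.Models S ∧
      ∃ a, ∀ ψ ∈ s, 0 ≤ M.eval ψ.1 a) :
    ∃ M : MetricStructure.{u, v, max u v} L, M.Models S ∧ ∃ a, ∀ ψ ∈ Γ, 0 ≤ M.eval ψ a := by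
  classical
  choose M hM a ha using h
  -- Refining `atTop` makes every `ψ` in `Γ` belong to `U`-almost every finite set.
  let U : Ultrafilter (Finset Γ) := Ultrafilter.of atTop
  refine ⟨ultraproduct U M, ultraproduct_models U M hM,
    fun j => PreUltraproduct.mk U M fun s => a s j, fun ψ hψ => ?_⟩
  refine ge_of_tendsto (tendsto_eval_ultraproduct U M ψ fun j s => a s j) ?_
  filter_upwards [Ultrafilter.of_le atTop (Ici_mem_atTop ({⟨ψ, hψ⟩} : Finset Γ))] with s hs
  exact ha s ⟨ψ, hψ⟩ (hs (Finset.mem_singleton_self _))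

/-- The affine type of a tuple in a structure. -/
noncomputable def MetricStructure.affineType (M : MetricStructure.{u, v, w} L) {n : ℕ}
    (a : Fin n → M.carrier) : AffineFormula L n → ℝ :=
  fun φ => M.eval φ.1 a

/-- With `exists_finset_forall_eq_sum`, this lets a separating functional on types be read as an
affine formula. -/
theorem AffineFormula.exists_eval_eq_sum {n : ℕ} (s : Finset (AffineFormula L n))
    (r : AffineFormula L n → ℝ) :
    ∃ φ : AffineFormula L n, ∀ (M : MetricStructure.{u, v, w} L) (a : Fin n → M.carrier),
      M.eval φ.1 a = ∑ ψ ∈ s, r ψ * M.eval ψ.1 a := by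
  classical
  induction s using Finset.induction_on with
  | empty => exact ⟨(0 : ℝ) • 1, fun M a => zero_mul _⟩
  | insert ψ s hψ ih =>
      obtain ⟨φ, hφ⟩ := ih
      refine ⟨r ψ • ψ + φ, fun M a => ?_⟩
      rw [Finset.sum_insert hψ, ← hφ M a]
      rfl

/-! ### Type spaces and the back-and-forth between extremal models -/

namespace Theory

variable {T : Theory L} {n : ℕ}

theorem affineType_mem_typeSpace {M : MetricStructure.{u, v, max u v} L} (hM : M.Models T)
    (a : Fin n → M.carrier) : M.affineType a ∈ T.typeSpace n :=
  ⟨fun _ _ => rfl, fun _ _ => rfl, fun _ h => h M hM a, rfl⟩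

theorem convex_typeSpace : Convex ℝ (T.typeSpace n) := by
  intro p hp q hq s t hs ht hst
  refine ⟨fun φ ψ => ?_, fun r φ => ?_, fun φ h => ?_, ?_⟩
  · simp only [Pi.add_apply, Pi.smul_apply, smul_eq_mul, hp.1, hq.1]; ring
  · simp only [Pi.add_apply, Pi.smul_apply, smul_eq_mul, hp.2.1, hq.2.1]; ring
  · exact add_nonneg (mul_nonneg hs (hp.2.2.1 φ h)) (mul_nonneg ht (hq.2.2.1 φ h))
  · simp [hp.2.2.2, hq.2.2.2, hst]

theorem isClosed_typeSpace : IsClosed (T.typeSpace n) := by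
  simp only [typeSpace, Set.ofPred_and, Set.ofPred_forall]
  refine .inter ?_ (.inter ?_ (.inter ?_ ?_))
  · exact isClosed_iInter fun φ => isClosed_iInter fun ψ =>
      isClosed_eq (by fun_prop) (by fun_prop)
  · exact isClosed_iInter fun r => isClosed_iInter fun φ =>
      isClosed_eq (by fun_prop) (by fun_prop)
  · exact isClosed_iInter fun φ => isClosed_iInter fun _ =>
      isClosed_le (by fun_prop) (by fun_prop)
  · exact isClosed_eq (by fun_prop) (by fun_prop)

/-- Positivity on `C • 1 + φ` and `C • 1 - φ` confines each coordinate to a compact interval;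
Tychonoff's theorem does the rest. -/
theorem isCompact_typeSpace : IsCompact (T.typeSpace n) := by
  choose C hC using fun φ : AffineFormula L n =>
    Formula.exists_forall_abs_eval_le.{u, v, max u v} φ.1
  refine (isCompact_univ_pi fun φ => isCompact_Icc (a := -C φ) (b := C φ)).of_isClosed_subset
    isClosed_typeSpace fun p hp φ _ => ?_
  have h1 : 0 ≤ p (φ + C φ • 1) := hp.2.2.1 _ fun M _ a => by
    have := (abs_le.1 (hC φ M a)).1
    change 0 ≤ M.eval φ.1 a + C φ * 1
    linarith
  have h2 : 0 ≤ p ((-1 : ℝ) • φ + C φ • 1) := hp.2.2.1 _ fun M _ a => by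
    have := (abs_le.1 (hC φ M a)).2
    change 0 ≤ -1 * M.eval φ.1 a + C φ * 1
    linarith
  rw [hp.1, hp.2.1, hp.2.2.2] at h1
  rw [hp.1, hp.2.1, hp.2.1, hp.2.2.2] at h2
  constructor <;> linarith

/-- If `a` and `b` have the same affine type, then every extreme type realized over `a` is a limit
of types realized over `b`. -/
theorem affineType_snoc_mem_closure {M N : MetricStructure.{u, v, max u v} L}
    (hM : T.IsExtremalModel M) (hN : N.Models T) {a : Fin n → M.carrier} {b : Fin n → N.carrier}
    (hab : M.affineType a = N.affineType b) (c : M.carrier) :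
    M.affineType (Fin.snoc a c) ∈
      closure (Set.range fun d => N.affineType (Fin.snoc b d : Fin (n + 1) → N.carrier)) := by
  refine mem_closure_of_mem_extremePoints isCompact_typeSpace convex_typeSpace
    (Set.range_subset_iff.2 fun d => affineType_mem_typeSpace hN _) (hM.2 (n + 1) _) ?_
  by_contra hq
  obtain ⟨f, r, hf, hr⟩ :=
    geometric_hahn_banach_closed_point convex_closedConvexHull isClosed_closedConvexHull hq
  obtain ⟨s, k, hs⟩ := exists_finset_forall_eq_sum f
  obtain ⟨φ, hφ⟩ := AffineFormula.exists_eval_eq_sum.{u, v, max u v} s k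
  have h1 : N.eval (.sup φ.1) b ≤ r := N.eval_sup_le fun d => by
    have := hf _ (subset_closedConvexHull (Set.mem_range_self d))
    rw [hs] at this
    rw [hφ]
    exact this.le
  have h2 : r < M.eval φ.1 (Fin.snoc a c) := by
    rw [hs] at hr
    rw [hφ]
    exact hr
  -- The types agree on `sup φ` because affine formulas are closed under quantifiers.
  have h3 : M.eval (.sup φ.1) a = N.eval (.sup φ.1) b :=
    congrFun hab ⟨.sup φ.1, φ.2⟩
  linarith [M.eval_le_eval_sup φ.1 a c]

/-- Every extreme type over `a` is realized in an elementary extension over any tuple `b` with the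
same affine type. -/
theorem exists_extension_affineType_snoc {S : Theory L} {M N : MetricStructure.{u, v, max u v} L}
    (hM : T.IsExtremalModel M) (hN : N.Models T) (hNS : N.Models S) {a : Fin n → M.carrier}
    {b : Fin n → N.carrier} (hab : M.affineType a = N.affineType b) (c : M.carrier) :
    ∃ N' : MetricStructure.{u, v, max u v} L, N'.Models S ∧ ∃ (b' : Fin n → N'.carrier)
      (d : N'.carrier), (∀ φ : Formula L n, N'.eval φ b' = N.eval φ b) ∧
        N'.affineType (Fin.snoc b' d) = M.affineType (Fin.snoc a c) := by
  have : (comap (fun d => N.affineType (Fin.snoc b d : Fin (n + 1) → N.carrier))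
      (𝓝 (M.affineType (Fin.snoc a c)))).NeBot := by
    rw [comap_neBot_iff_frequently]
    simpa only [Set.mem_range] using
      mem_closure_iff_frequently.1 (affineType_snoc_mem_closure hM hN hab c)
  -- The ultrafilter lives on `N` itself: along it the types of `(b, d)` converge to the target, and
  -- the identity family then represents the new element.
  let U : Ultrafilter N.carrier := Ultrafilter.of
    (comap (fun d => N.affineType (Fin.snoc b d : Fin (n + 1) → N.carrier))
      (𝓝 (M.affineType (Fin.snoc a c))))
  have hU : Tendsto (fun d => N.affineType (Fin.snoc b d : Fin (n + 1) → N.carrier)) U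
      (𝓝 (M.affineType (Fin.snoc a c))) := tendsto_comap.mono_left (Ultrafilter.of_le _)
  rw [tendsto_pi_nhds] at hU
  let P : N.carrier → MetricStructure.{u, v, max u v} L := fun _ => N
  refine ⟨ultraproduct U P, ultraproduct_models U P fun _ => hNS,
    fun j => PreUltraproduct.mk U P fun _ => b j, PreUltraproduct.mk U P fun d => d,
    fun φ => ?_, funext fun φ => ?_⟩
  · exact tendsto_nhds_unique (tendsto_eval_ultraproduct U P φ fun j _ => b j)
      tendsto_const_nhds
  · refine tendsto_nhds_unique ?_ (hU φ)
    have h := tendsto_eval_ultraproduct U P φ.1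
      (Fin.snoc (fun j _ => b j) fun d => d : Fin (n + 1) → N.carrier → N.carrier)
    have e1 := snoc_mk U P (fun j _ => b j) fun d => d
    have e2 := snoc_apply_apply P (fun j _ => b j) fun d => d
    unfold MetricStructure.affineType
    rw [e1]
    exact h.congr fun d => congrArg (N.eval φ.1) (e2 d).symm

/-- In extremal models which form an elementary class, values of formulas are determined by
affine types. -/
theorem eval_eq_of_affineType_eq (hex : T.ExtremalTheoryExists) (φ : Formula L n)
    {M N : MetricStructure.{u, v, max u v} L} (hM : T.IsExtremalModel M)
    (hN : T.IsExtremalModel N) {a : Fin n → M.carrier} {b : Fin n → N.carrier}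
    (hab : M.affineType a = N.affineType b) : M.eval φ a = N.eval φ b := by
  -- The hypothesis quantifies over all pairs of extremal models, since the witness matching `c`
  -- lives in an extension of `N`.
  have hsup : ∀ {n : ℕ} (φ : Formula L (n + 1)),
      (∀ {M N : MetricStructure.{u, v, max u v} L}, T.IsExtremalModel M → T.IsExtremalModel N →
        ∀ {a : Fin (n + 1) → M.carrier} {b : Fin (n + 1) → N.carrier},
          M.affineType a = N.affineType b → M.eval φ a = N.eval φ b) →
      ∀ {M N : MetricStructure.{u, v, max u v} L}, T.IsExtremalModel M → T.IsExtremalModel N →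
        ∀ {a : Fin n → M.carrier} {b : Fin n → N.carrier},
          M.affineType a = N.affineType b → M.eval (.sup φ) a ≤ N.eval (.sup φ) b := by
    intro n φ h M N hM hN a b hab
    refine M.eval_sup_le fun c => ?_
    obtain ⟨N', hN', b', d, hb', hd⟩ :=
      exists_extension_affineType_snoc hM hN.1 ((hex.models_iff N).2 hN) hab c
    rw [← hb', ← h ((hex.models_iff N').1 hN') hM hd]
    exact N'.eval_le_eval_sup _ _ _
  induction φ generalizing M N with
  | one => rfl
  | d t₁ t₂ => exact congrFun hab ⟨.d t₁ t₂, trivial⟩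
  | rel R t => exact congrFun hab ⟨.rel R t, trivial⟩
  | add φ ψ hφ hψ => exact congrArg₂ (· + ·) (hφ hM hN hab) (hψ hM hN hab)
  | smul r φ hφ => exact congrArg (r * ·) (hφ hM hN hab)
  | min φ ψ hφ hψ => exact congrArg₂ Min.min (hφ hM hN hab) (hψ hM hN hab)
  | max φ ψ hφ hψ => exact congrArg₂ Max.max (hφ hM hN hab) (hψ hM hN hab)
  | sup φ hφ =>
      exact le_antisymm (hsup φ (fun hM hN _ _ h => hφ hM hN h) hM hN hab)
        (hsup φ (fun hM hN _ _ h => hφ hM hN h) hN hM hab.symm)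
  | inf φ hφ =>
      have h : ∀ {M N : MetricStructure.{u, v, max u v} L}, T.IsExtremalModel M →
          T.IsExtremalModel N → ∀ {a b}, M.affineType a = N.affineType b →
            M.eval (.smul (-1) φ) a = N.eval (.smul (-1) φ) b :=
        fun hM hN _ _ h => congrArg (-1 * ·) (hφ hM hN h)
      rw [MetricStructure.eval_inf_eq_neg_eval_sup, MetricStructure.eval_inf_eq_neg_eval_sup,
        le_antisymm (hsup _ h hM hN hab) (hsup _ h hN hM hab.symm)]

end Theory

/-! ### Stone–Weierstrass approximation by quantifier-free formulas -/

section StoneWeierstrass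

variable {S : Theory L} {n : ℕ}

/-- Two-point interpolation: rescale and translate a formula separating the points; if none exists,
the prescribed values agree and a constant works. -/
theorem exists_isQF_eval_eq_and_eq {M N : MetricStructure.{u, v, w} L} {φ : Formula L n}
    {a : Fin n → M.carrier} {b : Fin n → N.carrier}
    (h : (∀ ψ : Formula L n, ψ.IsQF → M.eval ψ a = N.eval ψ b) → M.eval φ a = N.eval φ b) :
    ∃ ψ : Formula L n, ψ.IsQF ∧ M.eval ψ a = M.eval φ a ∧ N.eval ψ b = N.eval φ b := by
  by_cases hab : ∀ ψ : Formula L n, ψ.IsQF → M.eval ψ a = N.eval ψ b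
  · exact ⟨.smul (M.eval φ a) .one, trivial, mul_one _, (mul_one _).trans (h hab)⟩
  · push Not at hab
    obtain ⟨ψ, hψ, hne⟩ := hab
    have hne' := sub_ne_zero.2 hne
    let r := (M.eval φ a - N.eval φ b) / (M.eval ψ a - N.eval ψ b)
    refine ⟨.add (.smul r ψ) (.smul (M.eval φ a - r * M.eval ψ a) .one), ⟨hψ, trivial⟩, ?_, ?_⟩
    · simp only [MetricStructure.eval]; ring
    · simp only [MetricStructure.eval, r]; field_simp; ring

/-- The first half of the lattice form of the Stone–Weierstrass theorem. -/
theorem exists_isQF_eval_eq_and_forall_le {φ : Formula L n}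
    (h : ∀ M N : MetricStructure.{u, v, max u v} L, M.Models S → N.Models S → ∀ a b,
      (∀ ψ : Formula L n, ψ.IsQF → M.eval ψ a = N.eval ψ b) → M.eval φ a = N.eval φ b)
    {ε : ℝ} (hε : 0 < ε) {M : MetricStructure.{u, v, max u v} L} (hM : M.Models S)
    (a : Fin n → M.carrier) :
    ∃ ψ : Formula L n, ψ.IsQF ∧ M.eval ψ a = M.eval φ a ∧
      ∀ N : MetricStructure.{u, v, max u v} L, N.Models S → ∀ b,
        N.eval ψ b ≤ N.eval φ b + ε := by
  by_contra! hcon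
  let G : Set (Formula L n) := {ψ | ψ.IsQF ∧ M.eval ψ a = M.eval φ a}
  -- `0 ≤ D ψ` encodes `φ + ε ≤ ψ`. If every `ψ` in `G` fails somewhere, compactness gives one tuple
  -- where all fail, against interpolation at `a` and that tuple.
  let D : Formula L n → Formula L n := fun ψ =>
    .add ψ (.add (.smul (-1) φ) (.smul (-ε) .one))
  have hD : ∀ (N : MetricStructure.{u, v, max u v} L) b ψ,
      0 ≤ N.eval (D ψ) b ↔ N.eval φ b + ε ≤ N.eval ψ b := by
    intro N b ψ
    simp only [D, MetricStructure.eval]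
    constructor <;> intro h <;> linarith
  -- `G` is closed under minima, and a tuple where the minimum fails is one where every member
  -- fails.
  have hmin : ∀ s : Finset (D '' G), ∃ ψ ∈ G,
      ∀ θ ∈ s, ∃ χ, D χ = θ.1 ∧ ∀ (N : MetricStructure.{u, v, max u v} L) b,
        N.eval ψ b ≤ N.eval χ b := by
    classical
    intro s
    induction s using Finset.induction_on with
    | empty =>
        exact ⟨.smul (M.eval φ a) .one, ⟨trivial, mul_one _⟩, by simp⟩
    | insert θ s _ ih =>
        obtain ⟨ψ, hψ, hs⟩ := ih
        obtain ⟨_, χ, hχ, rfl⟩ := θ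
        refine ⟨.min ψ χ, ⟨⟨hψ.1, hχ.1⟩, ?_⟩, fun θ hθ => ?_⟩
        · simp only [MetricStructure.eval, hψ.2, hχ.2, min_self]
        · rcases Finset.mem_insert.1 hθ with rfl | hθ
          · exact ⟨χ, rfl, fun N b => min_le_right _ _⟩
          · obtain ⟨χ', h1, h2⟩ := hs θ hθ
            exact ⟨χ', h1, fun N b => (min_le_left _ _).trans (h2 N b)⟩
  obtain ⟨N, hN, b, hb⟩ := exists_models_forall_nonneg (S := S) (D '' G) fun s => by
    obtain ⟨ψ, hψ, hs⟩ := hmin s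
    obtain ⟨N, hN, b, hb⟩ := hcon ψ hψ.1 hψ.2
    refine ⟨N, hN, b, fun θ hθ => ?_⟩
    obtain ⟨χ, h1, h2⟩ := hs θ hθ
    rw [← h1, hD]
    exact hb.le.trans (h2 N b)
  obtain ⟨ψ, hψ, h1, h2⟩ := exists_isQF_eval_eq_and_eq (h M N hM hN a b)
  have := (hD N b ψ).1 (hb _ ⟨ψ, ⟨hψ, h1⟩, rfl⟩)
  linarith

/-- The lattice form of the Stone–Weierstrass theorem for the space of quantifier-free types. -/
theorem exists_isQF_forall_abs_sub_le {φ : Formula L n}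
    (h : ∀ M N : MetricStructure.{u, v, max u v} L, M.Models S → N.Models S → ∀ a b,
      (∀ ψ : Formula L n, ψ.IsQF → M.eval ψ a = N.eval ψ b) → M.eval φ a = N.eval φ b)
    {ε : ℝ} (hε : 0 < ε) :
    ∃ ψ : Formula L n, ψ.IsQF ∧ ∀ M : MetricStructure.{u, v, max u v} L, M.Models S → ∀ a,
      |M.eval φ a - M.eval ψ a| ≤ ε := by
  by_contra! hcon
  -- Now `G` consists of the formulas satisfying the upper bound, which maxima preserve. A tuple
  -- where all of them fall short of `φ` by `ε` contradicts the preceding lemma applied there.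
  let G : Set (Formula L n) := {ψ | ψ.IsQF ∧ ∀ M : MetricStructure.{u, v, max u v} L,
    M.Models S → ∀ a, M.eval ψ a ≤ M.eval φ a + ε}
  let D : Formula L n → Formula L n := fun ψ =>
    .add φ (.add (.smul (-1) ψ) (.smul (-ε) .one))
  have hD : ∀ (N : MetricStructure.{u, v, max u v} L) b ψ,
      0 ≤ N.eval (D ψ) b ↔ N.eval ψ b + ε ≤ N.eval φ b := by
    intro N b ψ
    simp only [D, MetricStructure.eval]
    constructor <;> intro h <;> linarith
  have hmax : ∀ s : Finset (D '' G), ∃ ψ ∈ G,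
      ∀ θ ∈ s, ∃ χ, D χ = θ.1 ∧ ∀ (N : MetricStructure.{u, v, max u v} L) b,
        N.eval χ b ≤ N.eval ψ b := by
    classical
    intro s
    induction s using Finset.induction_on with
    | empty =>
        obtain ⟨C, hC⟩ := Formula.exists_forall_abs_eval_le.{u, v, max u v} φ
        refine ⟨.smul (-C) .one, ⟨trivial, fun M _ a => ?_⟩, by simp⟩
        have := (abs_le.1 (hC M a)).1
        simp only [MetricStructure.eval]
        linarith
    | insert θ s _ ih =>
        obtain ⟨ψ, hψ, hs⟩ := ih
        obtain ⟨_, χ, hχ, rfl⟩ := θ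
        refine ⟨.max ψ χ, ⟨⟨hψ.1, hχ.1⟩, fun M hM a => ?_⟩, fun θ hθ => ?_⟩
        · exact max_le (hψ.2 M hM a) (hχ.2 M hM a)
        · rcases Finset.mem_insert.1 hθ with rfl | hθ
          · exact ⟨χ, rfl, fun N b => le_max_right _ _⟩
          · obtain ⟨χ', h1, h2⟩ := hs θ hθ
            exact ⟨χ', h1, fun N b => (h2 N b).trans (le_max_left _ _)⟩
  obtain ⟨N, hN, b, hb⟩ := exists_models_forall_nonneg (S := S) (D '' G) fun s => by
    obtain ⟨ψ, hψ, hs⟩ := hmax s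
    obtain ⟨N, hN, b, hb⟩ := hcon ψ hψ.1
    refine ⟨N, hN, b, fun θ hθ => ?_⟩
    obtain ⟨χ, h1, h2⟩ := hs θ hθ
    rw [← h1, hD]
    have h3 := hψ.2 N hN b
    have h4 := h2 N b
    rcases lt_abs.1 hb with h5 | h5 <;> linarith
  obtain ⟨ψ, hψ, h1, h2⟩ := exists_isQF_eval_eq_and_forall_le h hε hN b
  have := (hD N b ψ).1 (hb _ ⟨ψ, ⟨hψ, h2⟩, rfl⟩)
  linarith

end StoneWeierstrass

/-! ### Transfer from affine to continuous logic -/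

namespace Theory

variable {T : Theory L}

/-- One quantifier-free formula approximates `φ` to within `ε / 2` at both tuples. -/
theorem HasQuantifierElimination.affineType_eq (hqe : T.HasQuantifierElimination .AL)
    {M N : MetricStructure.{u, v, max u v} L} (hM : M.Models T) (hN : N.Models T) {n : ℕ}
    {a : Fin n → M.carrier} {b : Fin n → N.carrier}
    (h : ∀ ψ : Formula L n, ψ.IsQF → M.eval ψ a = N.eval ψ b) :
    M.affineType a = N.affineType b := by
  funext φ
  refine eq_of_forall_dist_le fun ε hε => ?_
  obtain ⟨ψ, -, hψ, hφψ⟩ := hqe n φ.1 φ.2 (ε / 2) (half_pos hε)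
  have h1 := abs_le.1 (hφψ M hM a)
  have h2 := abs_le.1 (hφψ N hN b)
  rw [h ψ hψ] at h1
  rw [Real.dist_eq, abs_le]
  simp only [MetricStructure.affineType]
  constructor <;> linarith [h1.1, h1.2, h2.1, h2.2]

theorem HasQuantifierElimination.extremalTheory (hex : T.ExtremalTheoryExists)
    (hqe : T.HasQuantifierElimination .AL) : T.extremalTheory.HasQuantifierElimination .CL := by
  intro n φ _ ε hε
  obtain ⟨ψ, hψ, h⟩ := exists_isQF_forall_abs_sub_le (S := T.extremalTheory) (φ := φ)
    (fun M N hM hN a b hab => by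
      rw [hex.models_iff] at hM hN
      exact eval_eq_of_affineType_eq hex φ hM hN (hqe.affineType_eq hM.1 hN.1 hab)) hε
  exact ⟨ψ, trivial, hψ, h⟩

theorem IsModelComplete.extremalTheory (hex : T.ExtremalTheoryExists)
    (hmc : T.IsModelComplete .AL) : T.extremalTheory.IsModelComplete .CL := by
  intro M N hM hN f hf n φ _ a
  rw [hex.models_iff] at hM hN
  exact eval_eq_of_affineType_eq hex φ hN hM
    (funext fun ψ => hmc M N hM.1 hN.1 f hf n ψ.1 ψ.2 a)

end Theory

end AffineLogic


theorem mainTheorem5 (L : AffineLogic.MetricLanguage) (T : AffineLogic.Theory L)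
    (hT : T.IsAffine) (hc : T.IsAffinelyComplete) (hex : T.ExtremalTheoryExists) :
    (T.HasQuantifierElimination AffineLogic.Fragment.AL →
      T.extremalTheory.HasQuantifierElimination AffineLogic.Fragment.CL) ∧
    (T.IsModelComplete AffineLogic.Fragment.AL →
      T.extremalTheory.IsModelComplete AffineLogic.Fragment.CL) :=
  ⟨.extremalTheory hex, .extremalTheory hex⟩
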